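/- Let $n,N\ge 0$ be integers and let $\hat a_1,\dots,\hat a_n,\hat a_1^\dagger,\dots,\hat a_n^\dagger$ be the bosonic annihilation and creation operators on $\ell_2(\mathbb N)^{\otimes n}$, with $[\hat a_i,\hat a_j^\dagger]=\delta_{ij}$, $[\hat a_i,\hat a_j]=[\hat a_i^\dagger,\hat a_j^\dagger]=0$. Put $\mathfrak a=(\hat a_1,\dots,\hat a_n,\hat a_1^\dagger,\dots,\hat a_n^\dagger)^T$, $$J=\begin{pmatrix}0&-I_n\\ I_n&0\end{pmatrix},\qquad E=\begin{pmatrix}0&I_n\\ I_n&0\end{pmatrix},\qquad \tilde K=E\overline KE\quad(K\in\mathbb C^{2n\times 2n}),$$ where $\overline K$ is the entrywise complex conjugate. Let $K_1,\dots,K_N\in\mathbb C^{2n\times 2n}$ satisfy $K_j=K_j^T=\tilde K_j$, put $C_j=\frac12\mathfrak a^TK_j\mathfrak a$, and consider the equation $$\frac{d}{dt}\rho_t=\mathcal L(\rho_t),\qquad \mathcal L(\rho)=-\frac12\sum_{j=1}^N[C_j,[C_j,\rho]],$$ understood through the matrix elements $\langle k|\cdot|\psi\rangle$ with $|k\rangle$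 a number vector and $\psi$ a finite linear combination of number vectors. Let $$\rho=\exp\Bigl(\tfrac12\mathfrak a^TM\mathfrak a+s\Bigr)$$ be a Gaussian state, where $M\in\mathbb C^{2n\times 2n}$, $M=M^T=\tilde M$, the Hermitian matrix $ME$ is negative definite, and $s\in\mathbb R$ is given by $e^s=\sqrt{|\det(e^{MJ}-I)|}$; here $\exp A$ denotes the value at $t=1$ of the strongly continuous semigroup $(e^{tA})_{t\ge0}$ generated by the closure of $A$ from the finite linear combinations of number vectors. Then $\rho$ is a stationary solution of the equation (that is, the constant curve $\rho_t=\rho$ is a solution) if and only if $$[K_jJ,\,e^{MJ}]=0\qquad\text{for all } j=1,\dots,N.$$ -/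

import Mathlib

open scoped Matrix ComplexOrder

noncomputable section

namespace BosonicGKSL

/-- Occupation numbers of `n` bosonic modes. -/
abbrev Occ (n : ℕ) : Type := Fin n → ℕ

/-- The Hilbert space of `n` bosonic modes: the `n`-fold tensor power of `ℓ²(ℕ)`, realised as
`ℓ²(ℕⁿ)` through its number basis `|k⟩ = |k₁⟩ ⊗ ⋯ ⊗ |kₙ⟩`. -/
abbrev Fock (n : ℕ) : Type := lp (fun _ : Occ n => ℂ) 2

/-- All coefficient families `k ↦ ⟨k|f⟩`, square summable or not. Every polynomial in the creation
and annihilation operators acts on them, since each coefficient of the result is a finite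
combination of coefficients of the argument. -/
abbrev Coeff (n : ℕ) : Type := Occ n → ℂ

/-- The annihilation operator `a i |k⟩ = √(k i) |k - e i⟩`. -/
def annihilation {n : ℕ} (i : Fin n) : Coeff n →ₗ[ℂ] Coeff n where
  toFun f k := (Real.sqrt ((k i : ℝ) + 1) : ℂ) * f (k + Pi.single i 1)
  map_add' f g := by ext k; simp [mul_add]
  map_smul' c f := by ext k; simp [mul_left_comm]

/-- The creation operator `a† i |k⟩ = √(k i + 1) |k + e i⟩`. (For `k i = 0` the coefficient of
the result at `k` is `0`.) -/
def creation {n : ℕ} (i : Fin n) : Coeff n →ₗ[ℂ] Coeff n where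
  toFun f k := (Real.sqrt (k i : ℝ) : ℂ) * f (k - Pi.single i 1)
  map_add' f g := by ext k; simp [mul_add]
  map_smul' c f := by ext k; simp [mul_left_comm]

/-- The index set of the `2n` entries of the vector `𝔞 = (a₁, …, aₙ, a₁†, …, aₙ†)ᵀ`. -/
abbrev Idx (n : ℕ) : Type := Fin n ⊕ Fin n

/-- The vector `𝔞 = (a₁, …, aₙ, a₁†, …, aₙ†)ᵀ` of operators. -/
def ladder {n : ℕ} : Idx n → (Coeff n →ₗ[ℂ] Coeff n) :=
  Sum.elim annihilation creation

/-- The operator `½ 𝔞ᵀ K 𝔞 = ½ ∑ₚ ∑_q K p q 𝔞ₚ 𝔞_q`. -/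
def quad {n : ℕ} (K : Matrix (Idx n) (Idx n) ℂ) : Coeff n →ₗ[ℂ] Coeff n :=
  (1 / 2 : ℂ) • ∑ p, ∑ q, K p q • (ladder p ∘ₗ ladder q)

/-- The dense space of finite linear combinations of the number vectors `|k⟩`. -/
def FinVec (n : ℕ) : Submodule ℂ (Coeff n) where
  carrier := {f | (Function.support f).Finite}
  zero_mem' := by simp
  add_mem' := fun {f g} hf hg => (hf.union hg).subset (Function.support_add f g)
  smul_mem' := fun c f hf => hf.subset (Function.support_const_smul_subset c f)

theorem ladder_mem {n : ℕ} (p : Idx n) {f : Coeff n} (hf : f ∈ FinVec n) :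
    ladder p f ∈ FinVec n := by
  have hf' : (Function.support f).Finite := hf
  change (Function.support (ladder p f)).Finite
  rcases p with i | i
  · refine (hf'.image (fun l => l - Pi.single i 1)).subset ?_
    intro k hk
    have h2 : f (k + Pi.single i 1) ≠ 0 := by
      intro h0
      exact hk (by simp [ladder, annihilation, h0])
    exact ⟨k + Pi.single i 1, h2, by simp⟩
  · refine (hf'.image (fun l => l + Pi.single i 1)).subset ?_
    intro k hk
    have h1 : k i ≠ 0 := by
      intro h0
      exact hk (by simp [ladder, creation, h0])
    have h2 : f (k - Pi.single i 1) ≠ 0 := by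
      intro h0
      exact hk (by simp [ladder, creation, h0])
    refine ⟨k - Pi.single i 1, h2, ?_⟩
    funext m
    by_cases hm : m = i
    · subst hm
      simp
      omega
    · simp [hm]

theorem quad_mem {n : ℕ} (K : Matrix (Idx n) (Idx n) ℂ) (f : Coeff n) (hf : f ∈ FinVec n) :
    quad K f ∈ FinVec n := by
  simp only [quad, LinearMap.smul_apply, LinearMap.sum_apply, LinearMap.comp_apply]
  exact Submodule.smul_mem _ _ (Submodule.sum_mem _ fun p _ => Submodule.sum_mem _ fun q _ =>
    Submodule.smul_mem _ _ (ladder_mem p (ladder_mem q hf)))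

/-- The operator `½ 𝔞ᵀ K 𝔞` on the finite vectors. -/
def quadFin {n : ℕ} (K : Matrix (Idx n) (Idx n) ℂ) : FinVec n →ₗ[ℂ] FinVec n :=
  (quad K).restrict (quad_mem K)

theorem memℓp_of_mem {n : ℕ} {f : Coeff n} (hf : f ∈ FinVec n) : Memℓp f 2 :=
  Memℓp.of_exponent_ge (memℓp_zero hf) zero_le

/-- The finite vectors as elements of the Hilbert space. -/
def toFock {n : ℕ} : FinVec n →ₗ[ℂ] Fock n where
  toFun f := ⟨f.1, memℓp_of_mem f.2⟩
  map_add' _ _ := rfl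
  map_smul' _ _ := rfl

/-- A bounded operator on the Hilbert space, as a map from finite vectors to coefficient
families (that is, its matrix in the number basis). -/
def onFin {n : ℕ} (ρ : Fock n →L[ℂ] Fock n) : FinVec n →ₗ[ℂ] Coeff n where
  toFun f := ⇑(ρ (toFock f))
  map_add' f g := by rw [map_add, map_add]; rfl
  map_smul' c f := by rw [map_smul, map_smul]; rfl

/-- The commutator `[½ 𝔞ᵀ K 𝔞, X]`. -/
def comm {n : ℕ} (K : Matrix (Idx n) (Idx n) ℂ) (X : FinVec n →ₗ[ℂ] Coeff n) :
    FinVec n →ₗ[ℂ] Coeff n :=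
  quad K ∘ₗ X - X ∘ₗ quadFin K

/-- The diffusion-type generator `𝓛(X) = -½ ∑ⱼ [Cⱼ, [Cⱼ, X]]`, where `Cⱼ = ½ 𝔞ᵀ Kⱼ 𝔞`. -/
def generator {n N : ℕ} (K : Fin N → Matrix (Idx n) (Idx n) ℂ) (X : FinVec n →ₗ[ℂ] Coeff n) :
    FinVec n →ₗ[ℂ] Coeff n :=
  -((1 / 2 : ℂ) • ∑ j, comm (K j) (comm (K j) X))

/-- `t ↦ ρ t`, `t ≥ 0`, solves `d/dt ρ t = 𝓛(ρ t)`: the equation holds for all matrix elements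
`⟨k| ⬝ |ψ⟩` with `|k⟩` a number vector and `ψ` a finite vector. -/
def IsSolution {n N : ℕ} (K : Fin N → Matrix (Idx n) (Idx n) ℂ)
    (ρ : ℝ → (Fock n →L[ℂ] Fock n)) : Prop :=
  ∀ t : ℝ, 0 ≤ t → ∀ (ψ : FinVec n) (k : Occ n),
    HasDerivWithinAt (fun τ => onFin (ρ τ) ψ k) (generator K (onFin (ρ t)) ψ k) (Set.Ici 0) t

/-- `ρ` is a stationary solution of `d/dt ρ t = 𝓛(ρ t)`. -/
def IsStationary {n N : ℕ} (K : Fin N → Matrix (Idx n) (Idx n) ℂ)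
    (ρ : Fock n →L[ℂ] Fock n) : Prop :=
  IsSolution K (fun _ => ρ)

/-- Strongly continuous one-parameter semigroups `T t`, `t ≥ 0`, of bounded operators. -/
structure IsC0Semigroup {H : Type*} [NormedAddCommGroup H] [NormedSpace ℂ H]
    (T : ℝ → (H →L[ℂ] H)) : Prop where
  zero : T 0 = 1
  add : ∀ s t : ℝ, 0 ≤ s → 0 ≤ t → T (s + t) = T s * T t
  continuousOn : ∀ ψ : H, ContinuousOn (fun t => T t ψ) (Set.Ici 0)

/-- The graph of the infinitesimal generator of `T`. -/
def generatorGraph {H : Type*} [NormedAddCommGroup H] [NormedSpace ℂ H]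
    (T : ℝ → (H →L[ℂ] H)) : Set (H × H) :=
  {x | HasDerivWithinAt (fun t => T t x.1) x.2 (Set.Ici 0) 0}

/-- `R = exp A`, for a possibly unbounded operator `A` given on the finite vectors: the closure of
`A` generates a strongly continuous semigroup `exp (t A)`, `t ≥ 0`, and `R` is its value at
`t = 1`. For `A` essentially self-adjoint on the finite vectors and bounded above, this is the
exponential of the closure of `A` in the functional calculus. -/
def IsExp {n : ℕ} (A : FinVec n →ₗ[ℂ] FinVec n) (R : Fock n →L[ℂ] Fock n) : Prop :=
  ∃ T : ℝ → (Fock n →L[ℂ] Fock n), IsC0Semigroup T ∧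
    generatorGraph T = closure (Set.range fun ψ : FinVec n => (toFock ψ, toFock (A ψ))) ∧
    R = T 1

/-- The block matrix with rows `(0, I)` and `(I, 0)`. -/
def E (n : ℕ) : Matrix (Idx n) (Idx n) ℂ :=
  Matrix.fromBlocks 0 1 1 0

/-- The block matrix with rows `(0, -I)` and `(I, 0)`. -/
def J (n : ℕ) : Matrix (Idx n) (Idx n) ℂ :=
  Matrix.fromBlocks 0 (-1) 1 0

/-- The conjugation taking `K` to `E K̄ E`, with `K̄` the entrywise complex conjugate. -/
def tilde {n : ℕ} (K : Matrix (Idx n) (Idx n) ℂ) : Matrix (Idx n) (Idx n) ℂ :=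
  E n * K.map (starRingEnd ℂ) * E n

/-- `ρ` is the bosonic Gaussian state `exp (½ 𝔞ᵀ M 𝔞 + s)`: here `M = Mᵀ = M̃`, `M E < 0` and
`eˢ = √|det (exp (M J) - I)|`. -/
structure IsGaussianState {n : ℕ} (M : Matrix (Idx n) (Idx n) ℂ) (s : ℝ)
    (ρ : Fock n →L[ℂ] Fock n) : Prop where
  symm : Mᵀ = M
  tilde_eq : tilde M = M
  neg : (-(M * E n)).PosDef
  normalisation : Real.exp s = Real.sqrt ‖(NormedSpace.exp (M * J n) - 1).det‖
  eq_exp : IsExp (quadFin M + (s : ℂ) • LinearMap.id) ρ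

end BosonicGKSL

end

open scoped Matrix ComplexOrder

noncomputable section

namespace BosonicGKSL

open Filter Topology Set

/-! ### Analytic vectors of strongly continuous semigroups. -/

section Semigroup

variable {H : Type*} [NormedAddCommGroup H] [NormedSpace ℂ H] {T : ℝ → (H →L[ℂ] H)}

/-! The Gaussian operator acts on the ladder operators linearly: with `S = exp (J M)`, `ρ 𝔞 = S 𝔞
ρ`, so a quadratic `C` with matrix `K` satisfies `ρ C = C' ρ`, where `C'` has matrix `K' = Sᵀ K S`.
Moving `ρ` to the right turns the stationarity equation into `∑ⱼ (Cⱼ² - 2 Cⱼ Cⱼ' + Cⱼ'²) ρ = 0`. The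
range of `ρ` is dense, so the quartic polynomial in front of `ρ` vanishes, and so does its leading
symbol: `∑ⱼ (zᵀ Kⱼ z - zᵀ Kⱼ' z)² = 0` for all complex `z`.

Complex squares may cancel, so `z` must be chosen well. For `z = exp (-J M / 2) w` with `w` real for
the conjugation `tilde`, every difference is purely imaginary. The sum is then minus a sum of real
squares, each difference vanishes, and polarisation gives `Kⱼ' = Kⱼ`. The symplectic identity `exp
(M J) Sᵀ = 1` turns this into the commutation relation (`conj_exp_eq_iff_commute`).

The analytic point is the relation `ρ 𝔞 = S 𝔞 ρ` for unbounded `𝔞`. Finite vectors are analytic for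
the generator with a common radius (`exists_analytic_bound`), also in the graph norm of the ladder
operators. A twisted semigroup therefore preserves the closure of their graph (`mem_closure_range`),
and this is the relation (`IsExp.ladder_onFin`). The same Taylor estimate gives the dense range
(`denseRange_one`). -/

theorem IsC0Semigroup.hasDerivWithinAt (hT : IsC0Semigroup T) {x y : H}
    (h : HasDerivWithinAt (fun t => T t x) y (Ici 0) 0) {t : ℝ} (ht : 0 ≤ t) :
    HasDerivWithinAt (fun t => T t x) (T t y) (Ici t) t := by
  have h1 : HasDerivWithinAt (fun τ : ℝ => T (τ - t) x) y (Ici t) t := by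
    have h2 : HasDerivWithinAt (fun t => T t x) y (Ici 0) (t - t) := by rwa [sub_self]
    have h3 := HasDerivWithinAt.scomp (h := fun τ : ℝ => τ - t) t h2
      (((hasDerivAt_id t).sub_const t).hasDerivWithinAt (s := Ici t))
      (fun τ (hτ : t ≤ τ) => sub_nonneg.2 hτ)
    simpa [Function.comp_def] using h3
  have h4 := ((T t).restrictScalars ℝ).hasFDerivAt.comp_hasDerivWithinAt t h1
  refine h4.congr_of_mem (fun τ hτ => ?_) self_mem_Ici
  have h5 := hT.add t (τ - t) ht (by simpa using hτ)
  rw [add_sub_cancel] at h5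
  simp [h5]

theorem IsC0Semigroup.exists_norm_le [CompleteSpace H] (hT : IsC0Semigroup T) :
    ∃ B : ℝ, 0 ≤ B ∧ ∀ t ∈ Icc (0 : ℝ) 1, ‖T t‖ ≤ B := by
  obtain ⟨B, hB⟩ := banach_steinhaus (g := fun t : Icc (0 : ℝ) 1 => T t) (fun x => by
    obtain ⟨C, hC⟩ := isCompact_Icc.exists_bound_of_continuousOn
      ((hT.continuousOn x).mono fun t ht => ht.1)
    exact ⟨C, fun t => hC t t.2⟩)
  exact ⟨B, (norm_nonneg _).trans (hB ⟨0, by simp⟩), fun t ht => hB ⟨t, ht⟩⟩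

theorem IsC0Semigroup.pow (hT : IsC0Semigroup T) {t : ℝ} (ht : 0 ≤ t) (m : ℕ) :
    T (m * t) = T t ^ m := by
  induction m with
  | zero => simp [hT.zero]
  | succ m ih =>
    rw [pow_succ, ← ih, ← hT.add _ _ (by positivity) ht]
    push_cast
    ring_nf

variable {V : Type*} [AddCommGroup V] [Module ℂ V] {ι : V →ₗ[ℂ] H} {A : V →ₗ[ℂ] V}

/-- The derivative telescopes: differentiating `T τ` in one term cancels the derivative of the power
in the next, leaving only the top term. -/
theorem hasDerivWithinAt_taylor (hT : IsC0Semigroup T)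
    (hA : ∀ v, HasDerivWithinAt (fun t => T t (ι v)) (ι (A v)) (Ici 0) 0) (v : V) (a : ℝ) (N : ℕ)
    {t : ℝ} (ht : 0 ≤ t) :
    HasDerivWithinAt
      (fun τ => ∑ m ∈ Finset.range (N + 1), ((a - τ) ^ m / m.factorial) • T τ (ι ((A ^ m) v)))
      (((a - t) ^ N / N.factorial) • T t (ι ((A ^ (N + 1)) v))) (Ici t) t := by
  have hder : ∀ m, HasDerivWithinAt (fun τ => T τ (ι ((A ^ m) v)))
      (T t (ι ((A ^ (m + 1)) v))) (Ici t) t := fun m => by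
    have := hT.hasDerivWithinAt (hA ((A ^ m) v)) ht
    rwa [← Module.End.mul_apply, ← pow_succ'] at this
  induction N with
  | zero => simpa using hder 0
  | succ N ih =>
    simp_rw [Finset.sum_range_succ _ (N + 1)]
    have hp : HasDerivWithinAt (fun τ : ℝ => (a - τ) ^ (N + 1) / ((N + 1).factorial : ℝ))
        (-((a - t) ^ N / (N.factorial : ℝ))) (Ici t) t := by
      have h := ((((hasDerivAt_id t).const_sub a).pow (N + 1)).div_const
        ((N + 1).factorial : ℝ)).hasDerivWithinAt (s := Ici t)
      refine h.congr_deriv ?_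
      rw [Nat.factorial_succ]
      have h1 : (N.factorial : ℝ) ≠ 0 := by positivity
      have h2 : (N : ℝ) + 1 ≠ 0 := by positivity
      push_cast
      simp
      field_simp
    refine (ih.add (hp.smul (hder (N + 1)))).congr_deriv ?_
    module

/-- The mean value inequality on `[0, t]` bounds the difference by a multiple of `(N + 1) (t R) ^ (N
+ 1)`. Taking `a = t` approximates `T t (ι v)` by elements of the range of `ι`; taking `a = 0`
approximates `ι v` by elements of the range of `T t`. -/
theorem tendsto_taylor [CompleteSpace H] (hT : IsC0Semigroup T)
    (hA : ∀ v, HasDerivWithinAt (fun t => T t (ι v)) (ι (A v)) (Ici 0) 0) {R : ℝ} (hR : 0 ≤ R)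
    {v : V} {C : ℝ} (hC : ∀ m : ℕ, ‖ι ((A ^ m) v)‖ ≤ C * m.factorial * R ^ m)
    {t a : ℝ} (ht : 0 ≤ t) (ht1 : t ≤ 1) (htR : t * R < 1) (ha : a ∈ Icc 0 t) :
    Tendsto (fun N =>
      (∑ m ∈ Finset.range (N + 1), ((a - t) ^ m / m.factorial : ℝ) • T t (ι ((A ^ m) v))) -
      ∑ m ∈ Finset.range (N + 1), (a ^ m / m.factorial : ℝ) • ι ((A ^ m) v)) atTop (𝓝 0) := by
  obtain ⟨B, hB0, hB⟩ := hT.exists_norm_le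
  have hC0 : 0 ≤ C := by simpa using (norm_nonneg _).trans (hC 0)
  have key : ∀ N : ℕ, ‖(∑ m ∈ Finset.range (N + 1),
      ((a - t) ^ m / m.factorial : ℝ) • T t (ι ((A ^ m) v))) -
      ∑ m ∈ Finset.range (N + 1), (a ^ m / m.factorial : ℝ) • ι ((A ^ m) v)‖ ≤
      (B * C) * (((N + 1 : ℕ) : ℝ) * (t * R) ^ (N + 1)) := fun N => by
    have h := norm_image_sub_le_of_norm_deriv_right_le_segment (a := 0) (b := t)
      (f := fun τ => ∑ m ∈ Finset.range (N + 1), ((a - τ) ^ m / m.factorial : ℝ) •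
        T τ (ι ((A ^ m) v)))
      (f' := fun τ => ((a - τ) ^ N / N.factorial : ℝ) • T τ (ι ((A ^ (N + 1)) v)))
      (C := t ^ N / N.factorial * (B * (C * (N + 1).factorial * R ^ (N + 1)))) ?_
      (fun τ hτ => hasDerivWithinAt_taylor hT hA v a N hτ.1) ?_ t ⟨ht, le_rfl⟩
    · simp only [sub_zero, hT.zero, one_apply_eq_self] at h
      refine h.trans (le_of_eq ?_)
      have h1 : (N.factorial : ℝ) ≠ 0 := by positivity
      rw [Nat.factorial_succ]
      push_cast
      field_simp
      ring
    · refine continuousOn_finsetSum _ fun m _ => ContinuousOn.smul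
        (f := fun τ : ℝ => (a - τ) ^ m / (m.factorial : ℝ)) (by fun_prop) ?_
      exact (hT.continuousOn _).mono Icc_subset_Ici_self
    · rintro τ ⟨hτ0, hτt⟩
      rw [norm_smul]
      have habs : |a - τ| ≤ t := abs_le.2 ⟨by linarith [ha.1], by linarith [ha.2]⟩
      refine mul_le_mul ?_ ?_ (norm_nonneg _) (by positivity)
      · rw [norm_div, norm_pow, Real.norm_eq_abs, Real.norm_natCast]
        gcongr
      · refine ((T τ).le_opNorm _).trans ?_
        exact mul_le_mul (hB τ ⟨hτ0, by linarith⟩) (hC _) (norm_nonneg _) hB0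
  refine squeeze_zero_norm key ?_
  have h := ((tendsto_add_atTop_iff_nat 1).2 (tendsto_self_mul_const_pow_of_lt_one
    (mul_nonneg ht hR) htR)).const_mul (B * C)
  simpa using h

theorem mem_closure_range_of_small
    [CompleteSpace H] (hT : IsC0Semigroup T)
    (hA : ∀ v, HasDerivWithinAt (fun t => T t (ι v)) (ι (A v)) (Ici 0) 0) {R : ℝ} (hR : 0 ≤ R)
    (hC : ∀ v, ∃ C : ℝ, ∀ m : ℕ, ‖ι ((A ^ m) v)‖ ≤ C * m.factorial * R ^ m)
    {t : ℝ} (ht : 0 ≤ t) (ht1 : t ≤ 1) (htR : t * R < 1) (v : V) :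
    T t (ι v) ∈ closure (range ι) := by
  obtain ⟨C, hC⟩ := hC v
  have h := tendsto_taylor hT hA hR hC ht ht1 htR (a := t) ⟨ht, le_rfl⟩
  simp only [sub_self, Finset.sum_range_succ' _, pow_succ, mul_zero, zero_div, zero_smul,
    Finset.sum_const_zero, zero_add, pow_zero, Nat.factorial_zero, Nat.cast_one, div_one,
    one_smul, Module.End.one_apply] at h
  have h2 := h.const_sub (T t (ι v))
  simp only [sub_sub_cancel, sub_zero] at h2
  refine mem_closure_of_tendsto h2 (Eventually.of_forall fun N => ?_)
  refine (LinearMap.range ι).add_mem (Submodule.sum_mem _ fun m _ => ?_) ⟨v, rfl⟩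
  rw [← Complex.coe_smul]
  exact Submodule.smul_mem _ _ ⟨_, rfl⟩

theorem mem_closure_range_semigroup
    [CompleteSpace H] (hT : IsC0Semigroup T)
    (hA : ∀ v, HasDerivWithinAt (fun t => T t (ι v)) (ι (A v)) (Ici 0) 0) {R : ℝ} (hR : 0 ≤ R)
    (hC : ∀ v, ∃ C : ℝ, ∀ m : ℕ, ‖ι ((A ^ m) v)‖ ≤ C * m.factorial * R ^ m)
    {t : ℝ} (ht : 0 ≤ t) (ht1 : t ≤ 1) (htR : t * R < 1) (v : V) :
    ι v ∈ closure (range (T t)) := by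
  obtain ⟨C, hC⟩ := hC v
  have h := tendsto_taylor hT hA hR hC ht ht1 htR (a := 0) ⟨le_rfl, ht⟩
  rw [← tendsto_sub_nhds_zero_iff]  at h
  have h2 := h.add_const (ι v)
  simp only [Finset.sum_range_succ' (fun m => ((0 : ℝ) ^ m / (m.factorial : ℝ)) • ι ((A ^ m) v)),
    pow_succ, mul_zero, zero_div, zero_smul,
    Finset.sum_const_zero, zero_add, pow_zero, Nat.factorial_zero, Nat.cast_one, div_one,
    one_smul, Module.End.one_apply, sub_zero, sub_add_cancel] at h2
  refine mem_closure_of_tendsto h2 (Eventually.of_forall fun N => ?_)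
  refine Submodule.sum_mem (LinearMap.range (T t).toLinearMap) fun m _ => ?_
  rw [← Complex.coe_smul]
  exact Submodule.smul_mem _ _ ⟨_, rfl⟩

/-- Taylor series only reach times below `1 / R`; time `1` is a power of such a step. This needs `R`
to be the same for all vectors. -/
theorem exists_small_step (R : ℝ) : ∃ m : ℕ, ∃ t : ℝ, 0 ≤ t ∧ t ≤ 1 ∧ t * R < 1 ∧ m * t = 1 := by
  obtain ⟨m, hm⟩ := exists_nat_gt R
  refine ⟨m + 1, 1 / (m + 1), by positivity, ?_, ?_, ?_⟩
  · rw [div_le_one (by positivity)]; simp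
  · rw [one_div_mul_eq_div, div_lt_one (by positivity)]; linarith
  · push_cast; field_simp

/-- If the vectors `ι v` are analytic for the generator, uniformly in `v`, then the closure of
their space is invariant under the semigroup. -/
theorem mem_closure_range
    [CompleteSpace H] (hT : IsC0Semigroup T)
    (hA : ∀ v, HasDerivWithinAt (fun t => T t (ι v)) (ι (A v)) (Ici 0) 0) {R : ℝ} (hR : 0 ≤ R)
    (hC : ∀ v, ∃ C : ℝ, ∀ m : ℕ, ‖ι ((A ^ m) v)‖ ≤ C * m.factorial * R ^ m)
    (v : V) : T 1 (ι v) ∈ closure (range ι) := by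
  obtain ⟨m, t, ht, ht1, htR, hmt⟩ := exists_small_step R
  have hmaps : MapsTo (T t) (closure (range ι)) (closure (range ι)) := by
    have h : MapsTo (T t) (range ι) (closure (range ι)) := by
      rintro _ ⟨w, rfl⟩
      exact mem_closure_range_of_small hT hA hR hC ht ht1 htR w
    simpa using h.closure (T t).continuous
  have hpow : ⇑(T t ^ m) = (T t)^[m] := FunLike.coe_pow_eq_iterate (T t) m
  rw [← hmt, hT.pow ht, hpow]
  exact hmaps.iterate m (subset_closure ⟨v, rfl⟩)

theorem denseRange_one
    [CompleteSpace H] (hT : IsC0Semigroup T)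
    (hA : ∀ v, HasDerivWithinAt (fun t => T t (ι v)) (ι (A v)) (Ici 0) 0) {R : ℝ} (hR : 0 ≤ R)
    (hC : ∀ v, ∃ C : ℝ, ∀ m : ℕ, ‖ι ((A ^ m) v)‖ ≤ C * m.factorial * R ^ m)
    (hι : DenseRange ι) : DenseRange (T 1) := by
  obtain ⟨m, t, ht, ht1, htR, hmt⟩ := exists_small_step R
  have hd : DenseRange (T t) := by
    refine fun x => closure_minimal ?_ isClosed_closure (hι x)
    rintro _ ⟨v, rfl⟩
    exact mem_closure_range_semigroup hT hA hR hC ht ht1 htR v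
  rw [← hmt, hT.pow ht]
  clear hmt
  induction m with
  | zero => exact Function.surjective_id.denseRange
  | succ m ih =>
    rw [pow_succ]
    exact ih.comp hd (T t ^ m).continuous

end Semigroup

/-! ### The canonical commutation relations. -/

section Algebra

variable {n : ℕ}

theorem annihilation_comm (i j : Fin n) :
    annihilation i * annihilation j = (annihilation j * annihilation i : Module.End ℂ (Coeff n)) := by
  rcases eq_or_ne i j with rfl | h
  · rfl
  · ext f k
    simp only [Module.End.mul_apply, annihilation, LinearMap.coe_mk, AddHom.coe_mk, Pi.add_apply,
      Pi.single_eq_of_ne h, Pi.single_eq_of_ne h.symm, add_zero]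
    rw [add_right_comm k]
    ring

theorem creation_comm (i j : Fin n) :
    creation i * creation j = (creation j * creation i : Module.End ℂ (Coeff n)) := by
  rcases eq_or_ne i j with rfl | h
  · rfl
  · ext f k
    simp only [Module.End.mul_apply, creation, LinearMap.coe_mk, AddHom.coe_mk, Pi.sub_apply,
      Pi.single_eq_of_ne h, Pi.single_eq_of_ne h.symm, Nat.sub_zero]
    rw [tsub_right_comm (a := k)]
    ring

theorem sub_single_add_single {k : Occ n} {i : Fin n} (h : k i ≠ 0) :
    k - Pi.single i 1 + Pi.single i 1 = k := by
  refine tsub_add_cancel_of_le fun m => ?_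
  rcases eq_or_ne m i with rfl | hm
  · simpa using Nat.one_le_iff_ne_zero.2 h
  · simp [hm]

theorem annihilation_creation_comm (i j : Fin n) :
    annihilation i * creation j - creation j * annihilation i =
      ((if i = j then 1 else 0 : ℂ) • 1 : Module.End ℂ (Coeff n)) := by
  ext f k
  rcases eq_or_ne i j with rfl | h
  · simp only [LinearMap.sub_apply, Module.End.mul_apply, creation, annihilation, LinearMap.coe_mk,
      AddHom.coe_mk, Pi.sub_apply, Pi.add_apply, Pi.single_eq_same, add_tsub_cancel_right,
      if_true, one_smul, Module.End.one_apply]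
    have h1 (x : ℝ) (hx : 0 ≤ x) : (Real.sqrt x : ℂ) * Real.sqrt x = x := by
      rw [← Complex.ofReal_mul, Real.mul_self_sqrt hx]
    rcases Nat.eq_zero_or_pos (k i) with h0 | h0
    · simp [h0]
    · have h2 := sub_single_add_single h0.ne'
      have h3 : ((k i - 1 : ℕ) : ℝ) + 1 = k i := by
        rw [Nat.cast_sub h0]; simp
      rw [h2, h3, ← mul_assoc, ← mul_assoc]
      push_cast
      rw [h1 _ (by positivity), h1 _ (by positivity)]
      push_cast
      ring
  · have h2 : k + Pi.single i 1 - Pi.single j 1 = k - Pi.single j 1 + Pi.single i 1 := by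
      funext m
      simp only [Pi.add_apply, Pi.sub_apply, Pi.single_apply]
      split_ifs <;> omega
    simp only [LinearMap.sub_apply, Module.End.mul_apply, creation, annihilation, LinearMap.coe_mk,
      AddHom.coe_mk, Pi.sub_apply, Pi.add_apply, Pi.single_eq_of_ne h, Pi.single_eq_of_ne h.symm,
      add_zero, Nat.sub_zero, if_neg h, zero_smul, LinearMap.zero_apply, Pi.zero_apply, h2]
    ring

/-- The canonical commutation relations. -/
theorem ladder_comm (p q : Idx n) :
    ladder p * ladder q - ladder q * ladder p = ((-J n) p q • 1 : Module.End ℂ (Coeff n)) := by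
  rcases p with i | i <;> rcases q with j | j
  · simp [ladder, J, annihilation_comm i j]
  · simpa [ladder, J, Matrix.one_apply] using annihilation_creation_comm i j
  · refine (neg_sub _ _).symm.trans
      ((congrArg Neg.neg (annihilation_creation_comm j i)).trans ((neg_smul _ _).symm.trans ?_))
    congr 1
    simp [J, Matrix.one_apply, eq_comm]
  · simp [ladder, J, creation_comm i j]

end Algebra

/-! ### Commutators of linear and quadratic forms in abstract operators. -/

section CCR

variable {ι R : Type*} [Fintype ι] [Ring R] [Algebra ℂ R]

/-- The linear combination `∑ₚ v p Lₚ`. -/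
def linForm (L : ι → R) (v : ι → ℂ) : R := ∑ p, v p • L p

/-- The quadratic expression `½ ∑ₚ ∑_q K p q Lₚ L_q`. -/
def quadForm (L : ι → R) (K : Matrix ι ι ℂ) : R :=
  (1 / 2 : ℂ) • ∑ p, ∑ q, K p q • (L p * L q)

variable {L : ι → R} {Ω : Matrix ι ι ℂ}

theorem linForm_comm (hL : ∀ p q, L p * L q - L q * L p = Ω p q • (1 : R)) (v : ι → ℂ) (q : ι) :
    linForm L v * L q - L q * linForm L v = (v ᵥ* Ω) q • (1 : R) := by
  simp only [linForm, Finset.sum_mul, Finset.mul_sum, ← Finset.sum_sub_distrib, smul_mul_assoc,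
    mul_smul_comm, ← smul_sub, hL, smul_smul, ← Finset.sum_smul]
  rfl

theorem linForm_comm_linForm (hL : ∀ p q, L p * L q - L q * L p = Ω p q • (1 : R))
    (v w : ι → ℂ) :
    linForm L v * linForm L w - linForm L w * linForm L v = ((v ᵥ* Ω) ⬝ᵥ w) • (1 : R) := by
  simp only [linForm.eq_1 L w, Finset.sum_mul, Finset.mul_sum, ← Finset.sum_sub_distrib,
    smul_mul_assoc, mul_smul_comm, ← smul_sub, linForm_comm hL, smul_smul, ← Finset.sum_smul]
  simp [dotProduct, mul_comm]

theorem linForm_comm_quadForm (hL : ∀ p q, L p * L q - L q * L p = Ω p q • (1 : R)) (v : ι → ℂ)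
    {K : Matrix ι ι ℂ} (hK : Kᵀ = K) :
    linForm L v * quadForm L K - quadForm L K * linForm L v = linForm L (K *ᵥ (v ᵥ* Ω)) := by
  set z := v ᵥ* Ω with hz
  have h1 (p q : ι) : linForm L v * (L p * L q) - L p * L q * linForm L v =
      z p • L q + z q • L p := by
    have hp := linForm_comm hL v p
    have hq := linForm_comm hL v q
    rw [← hz, sub_eq_iff_eq_add] at hp hq
    rw [← mul_assoc, hp, mul_assoc, add_mul, mul_assoc, hq, mul_add]
    simp only [smul_mul_assoc, mul_smul_comm, one_mul, mul_one]
    abel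
  simp only [quadForm, Finset.sum_mul, Finset.mul_sum, smul_mul_assoc, mul_smul_comm, ← smul_sub,
    ← Finset.sum_sub_distrib, h1]
  have h2 : ∑ p, ∑ q, K p q • (z p • L q + z q • L p) = (2 : ℂ) • ∑ p, ∑ q, K p q • z q • L p := by
    simp only [smul_add, Finset.sum_add_distrib]
    rw [two_smul]
    congr 1
    rw [Finset.sum_comm]
    refine Finset.sum_congr rfl fun p _ => Finset.sum_congr rfl fun q _ => ?_
    rw [Matrix.IsSymm.apply hK]
  rw [h2, smul_smul]
  simp only [linForm, Matrix.mulVec, dotProduct, Finset.sum_smul, smul_smul]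
  norm_num

theorem quadForm_comm [DecidableEq ι] (hL : ∀ p q, L p * L q - L q * L p = Ω p q • (1 : R)) {M : Matrix ι ι ℂ}
    (hM : Mᵀ = M) (p : ι) :
    quadForm L M * L p - L p * quadForm L M = ∑ q, (-Ω * M) p q • L q := by
  have h := linForm_comm_quadForm hL (Pi.single p 1) hM
  have h1 : linForm L (Pi.single p 1) = L p := by
    simp [linForm, Pi.single_apply]
  rw [h1] at h
  rw [← neg_sub, h, linForm, ← Finset.sum_neg_distrib]
  refine Finset.sum_congr rfl fun q _ => ?_
  rw [← neg_smul]
  congr 1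
  simp [Matrix.mulVec, dotProduct, Matrix.mul_apply, Matrix.IsSymm.apply hM, mul_comm]

/-- `D` is a derivation whose third power kills both factors, so in the Leibniz formula only `D² c ·
D² c'` survives, with coefficient `6 = 4.choose 2`. The order of the factors leaves no trace. -/
theorem fourth_commutator_mul {x c u c' u' : R} {κ κ' : ℂ}
    (hc : x * c - c * x = u) (hu : x * u - u * x = κ • 1) (hc' : x * c' - c' * x = u')
    (hu' : x * u' - u' * x = κ' • 1) :
    let D : R →ₗ[ℂ] R := LinearMap.mulLeft ℂ x - LinearMap.mulRight ℂ x
    D (D (D (D (c * c')))) = (6 * κ * κ') • 1 := by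
  intro D
  have hD (y : R) : D y = x * y - y * x := rfl
  have hmul (y z : R) : D (y * z) = D y * z + y * D z := by
    simp only [hD]; noncomm_ring
  simp only [hmul, map_add, map_smul, smul_mul_assoc, mul_smul_comm, hD c, hD c', hD u, hD u',
    hc, hc', hu, hu', one_mul, mul_one, smul_smul]
  module

/-- If a sum of squares of "twisted" commutators of quadratic expressions vanishes, then so does
its symbol, a sum of squares of differences of quadratic forms. -/
theorem sum_sq_sub_eq_zero [DecidableEq ι] [Nontrivial R] {Ω' : Matrix ι ι ℂ} (hΩ : Ω' * Ω = 1)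
    (hL : ∀ p q, L p * L q - L q * L p = Ω p q • (1 : R)) {N : ℕ}
    {K K' : Fin N → Matrix ι ι ℂ} (hK : ∀ j, (K j)ᵀ = K j) (hK' : ∀ j, (K' j)ᵀ = K' j)
    (h : ∑ j, (quadForm L (K j) * quadForm L (K j) -
      (2 : ℂ) • (quadForm L (K j) * quadForm L (K' j)) +
      quadForm L (K' j) * quadForm L (K' j)) = 0) (z : ι → ℂ) :
    ∑ j, (z ⬝ᵥ K j *ᵥ z - z ⬝ᵥ K' j *ᵥ z) ^ 2 = 0 := by
  -- Since `Ω` is invertible, every point `z` arises from a commutator with a linear form.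
  obtain ⟨v, hv⟩ : ∃ v : ι → ℂ, v ᵥ* Ω = z :=
    ⟨z ᵥ* Ω', by rw [Matrix.vecMul_vecMul, hΩ, Matrix.vecMul_one]⟩
  have h1 {B : Matrix ι ι ℂ} (hB : Bᵀ = B) := linForm_comm_quadForm hL v hB
  have h2 (B : Matrix ι ι ℂ) := linForm_comm_linForm hL v (B *ᵥ z)
  simp only [hv] at h1 h2
  have key := congrArg (fun y : R =>
    let D : R →ₗ[ℂ] R :=
      LinearMap.mulLeft ℂ (linForm L v) - LinearMap.mulRight ℂ (linForm L v)
    D (D (D (D y)))) h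
  simp only [map_sum, map_add, map_sub, map_smul, map_zero,
    fourth_commutator_mul (h1 (hK _)) (h2 _) (h1 (hK _)) (h2 _),
    fourth_commutator_mul (h1 (hK _)) (h2 _) (h1 (hK' _)) (h2 _),
    fourth_commutator_mul (h1 (hK' _)) (h2 _) (h1 (hK' _)) (h2 _)] at key
  simp only [smul_smul, ← sub_smul, ← add_smul, ← Finset.sum_smul] at key
  rw [smul_eq_zero, or_iff_left one_ne_zero] at key
  have h6 : (6 : ℂ) * ∑ j, (z ⬝ᵥ K j *ᵥ z - z ⬝ᵥ K' j *ᵥ z) ^ 2 = 0 := by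
    rw [← key, Finset.mul_sum]
    exact Finset.sum_congr rfl fun j _ => by ring
  simpa using h6

end CCR

theorem quad_eq {n : ℕ} (K : Matrix (Idx n) (Idx n) ℂ) :
    quad K = quadForm (R := Module.End ℂ (Coeff n)) ladder K := rfl

/-! ### Factorial growth of powers of the quadratic operator on finite vectors. -/

section Growth

open scoped ENNReal

variable {n : ℕ}

/-- The `ℓ¹` norm of a coefficient family. -/
def norm1 (f : Coeff n) : ℝ≥0∞ := ∑' k, ‖f k‖ₑ

theorem norm1_add (f g : Coeff n) : norm1 (f + g) ≤ norm1 f + norm1 g := by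
  rw [norm1, norm1, norm1, ← ENNReal.tsum_add]
  exact ENNReal.tsum_le_tsum fun k => enorm_add_le _ _

theorem norm1_smul (c : ℂ) (f : Coeff n) : norm1 (c • f) = ‖c‖ₑ * norm1 f := by
  simp [norm1, ENNReal.tsum_mul_left]

theorem norm1_sum {α : Type*} (s : Finset α) (f : α → Coeff n) :
    norm1 (∑ a ∈ s, f a) ≤ ∑ a ∈ s, norm1 (f a) :=
  Finset.le_sum_of_subadditive _ (by simp [norm1]) norm1_add s f

theorem norm1_lt_top {f : Coeff n} (hf : f ∈ FinVec n) : norm1 f < ∞ := by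
  have hf' : (Function.support f).Finite := hf
  rw [norm1, tsum_eq_sum (s := hf'.toFinset) (by simp)]
  exact ENNReal.sum_lt_top.2 fun k _ => enorm_lt_top

theorem toFock_eq_sum (f : FinVec n) (s : Finset (Occ n)) (hs : Function.support f.1 ⊆ s) :
    toFock f = ∑ k ∈ s, lp.single (E := fun _ => ℂ) 2 k (f.1 k) := by
  have h := lp.hasSum_single (p := 2) ENNReal.ofNat_ne_top (toFock f)
  refine h.unique (hasSum_sum_of_ne_finset_zero fun k hk => ?_)
  have : f.1 k = 0 := by
    by_contra h0
    exact hk (hs h0)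
  change lp.single (E := fun _ => ℂ) 2 k (f.1 k) = 0
  rw [this, lp.single_zero]

theorem enorm_toFock_le (f : FinVec n) : ‖toFock f‖ₑ ≤ norm1 f.1 := by
  have hf' : (Function.support f.1).Finite := f.2
  rw [toFock_eq_sum f hf'.toFinset (by simp)]
  refine (enorm_sum_le _ _).trans ?_
  refine le_trans (le_of_eq ?_) (ENNReal.sum_le_tsum hf'.toFinset)
  refine Finset.sum_congr rfl fun k _ => ?_
  rw [← ofReal_norm, lp.norm_single (by norm_num), ofReal_norm]

/-- The number vectors in `f` have total occupation number at most `d`. -/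
def DegLE (d : ℕ) (f : Coeff n) : Prop := ∀ k, f k ≠ 0 → ∑ i, k i ≤ d

theorem exists_degLE {f : Coeff n} (hf : f ∈ FinVec n) : ∃ d, DegLE d f := by
  have hf' : (Function.support f).Finite := hf
  refine ⟨∑ k ∈ hf'.toFinset, ∑ i, k i, fun k hk => ?_⟩
  exact Finset.single_le_sum (f := fun k : Occ n => ∑ i, k i) (fun _ _ => Nat.zero_le _)
    (by simpa using hk)

theorem DegLE.mono {d d' : ℕ} {f : Coeff n} (hf : DegLE d f) (h : d ≤ d') : DegLE d' f :=
  fun k hk => (hf k hk).trans h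

theorem DegLE.add {d : ℕ} {f g : Coeff n} (hf : DegLE d f) (hg : DegLE d g) :
    DegLE d (f + g) := fun k hk => by
  by_contra h
  have h1 : f k = 0 := by_contra fun h1 => h (hf k h1)
  have h2 : g k = 0 := by_contra fun h1 => h (hg k h1)
  exact hk (by simp [h1, h2])

theorem DegLE.smul {d : ℕ} {f : Coeff n} (hf : DegLE d f) (c : ℂ) :
    DegLE d (c • f) := fun k hk => hf k (right_ne_zero_of_mul hk)

theorem DegLE.sum {d : ℕ} {α : Type*} {s : Finset α} {f : α → Coeff n}
    (hf : ∀ a ∈ s, DegLE d (f a)) : DegLE d (∑ a ∈ s, f a) :=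
  Finset.sum_induction _ _ (fun _ _ h h' => h.add h') (fun _ hk => absurd rfl hk) hf

theorem sum_add_single (k : Occ n) (i : Fin n) :
    ∑ j, (k + Pi.single i 1 : Occ n) j = ∑ j, k j + 1 := by
  simp [Finset.sum_add_distrib]

theorem DegLE.ladder {d : ℕ} {f : Coeff n} (hf : DegLE d f) (p : Idx n) :
    DegLE (d + 1) (ladder p f) := by
  intro k hk
  rcases p with i | i
  · have h := hf _ (right_ne_zero_of_mul hk)
    rw [sum_add_single] at h
    omega
  · have h := hf _ (right_ne_zero_of_mul hk)
    have h1 : k i ≠ 0 := fun h0 => left_ne_zero_of_mul hk (by simp [h0])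
    rw [← sub_single_add_single h1, sum_add_single]
    omega

theorem annihilation_apply (i : Fin n) (f : Coeff n) (k : Occ n) :
    annihilation i f k = (Real.sqrt ((k i : ℝ) + 1) : ℂ) * f (k + Pi.single i 1) := rfl

theorem creation_apply (i : Fin n) (f : Coeff n) (k : Occ n) :
    creation i f k = (Real.sqrt (k i : ℝ) : ℂ) * f (k - Pi.single i 1) := rfl

theorem DegLE.le {d : ℕ} {f : Coeff n} (hf : DegLE d f) {k : Occ n} (hk : f k ≠ 0) (i : Fin n) :
    (k i : ℝ) ≤ d := by
  exact_mod_cast (Finset.single_le_sum (f := k) (fun _ _ => Nat.zero_le _)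
    (Finset.mem_univ i)).trans (hf k hk)

theorem enorm_sqrt_mul_le {x y : ℝ} {c : ℂ} (h : c ≠ 0 → x ≤ y) :
    ‖(Real.sqrt x : ℂ) * c‖ₑ ≤ ENNReal.ofReal (Real.sqrt y) * ‖c‖ₑ := by
  rcases eq_or_ne c 0 with rfl | hc
  · simp
  · rw [enorm_mul, ← ofReal_norm (Real.sqrt x : ℂ), Complex.norm_real,
      Real.norm_of_nonneg (Real.sqrt_nonneg _)]
    exact mul_le_mul_left (ENNReal.ofReal_le_ofReal (Real.sqrt_le_sqrt (h hc))) _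

theorem norm1_annihilation_le {d : ℕ} {f : Coeff n} (hf : DegLE d f) (i : Fin n) :
    norm1 (annihilation i f) ≤ ENNReal.ofReal (Real.sqrt (d + 1)) * norm1 f := by
  rw [norm1, norm1, ← ENNReal.tsum_mul_left]
  refine le_trans (ENNReal.tsum_le_tsum fun k => ?_)
    (ENNReal.tsum_comp_le_tsum_of_injective (add_left_injective (Pi.single i 1 : Occ n)) _)
  rw [annihilation_apply]
  refine enorm_sqrt_mul_le fun h => ?_
  have h1 := hf.le h i
  simp only [Pi.add_apply, Pi.single_eq_same, Nat.cast_add, Nat.cast_one] at h1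
  linarith

theorem norm1_creation_le {d : ℕ} {f : Coeff n} (hf : DegLE d f) (i : Fin n) :
    norm1 (creation i f) ≤ ENNReal.ofReal (Real.sqrt (d + 1)) * norm1 f := by
  have h : norm1 (creation i f) = ∑' k : Occ n, ‖creation i f (k + Pi.single i 1)‖ₑ := by
    refine ((add_left_injective (Pi.single i 1 : Occ n)).tsum_eq
      (f := fun k => ‖creation i f k‖ₑ) fun k hk => ?_).symm
    have h1 : k i ≠ 0 := fun h0 => hk (by simp [creation_apply, h0])
    exact ⟨_, sub_single_add_single h1⟩
  rw [h, norm1, ← ENNReal.tsum_mul_left]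
  refine ENNReal.tsum_le_tsum fun k => ?_
  rw [creation_apply, add_tsub_cancel_right]
  refine enorm_sqrt_mul_le fun h => ?_
  have h1 := hf.le h i
  simp only [Pi.add_apply, Pi.single_eq_same, Nat.cast_add, Nat.cast_one]
  linarith

theorem norm1_ladder_le {d : ℕ} {f : Coeff n} (hf : DegLE d f) (p : Idx n) :
    norm1 (ladder p f) ≤ ENNReal.ofReal (Real.sqrt (d + 1)) * norm1 f := by
  rcases p with i | i
  · exact norm1_annihilation_le hf i
  · exact norm1_creation_le hf i

theorem quad_apply (K : Matrix (Idx n) (Idx n) ℂ) (f : Coeff n) :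
    quad K f = (1 / 2 : ℂ) • ∑ p, ∑ q, K p q • ladder p (ladder q f) := by
  simp [quad, LinearMap.sum_apply]

theorem DegLE.quad {d : ℕ} {f : Coeff n} (hf : DegLE d f) (K : Matrix (Idx n) (Idx n) ℂ) :
    DegLE (d + 2) (quad K f) := by
  rw [quad_apply]
  exact (DegLE.sum fun p _ => DegLE.sum fun q _ => ((hf.ladder q).ladder p).smul _).smul _

theorem norm1_quad_le {d : ℕ} {f : Coeff n} (hf : DegLE d f) (K : Matrix (Idx n) (Idx n) ℂ) :
    norm1 (quad K f) ≤ (∑ p, ∑ q, ‖K p q‖ₑ) * (d + 2) * norm1 f := by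
  have h1 (p q : Idx n) : norm1 (ladder p (ladder q f)) ≤ (d + 2) * norm1 f := by
    refine (norm1_ladder_le (hf.ladder q) p).trans ?_
    refine (mul_le_mul_right (norm1_ladder_le hf q) _).trans ?_
    rw [← mul_assoc, ← ENNReal.ofReal_mul (Real.sqrt_nonneg _)]
    gcongr
    have : (d + 2 : ℝ≥0∞) = ENNReal.ofReal (d + 2) := by
      rw [ENNReal.ofReal_add (by positivity) (by norm_num)]; simp
    rw [this]
    refine ENNReal.ofReal_le_ofReal ?_
    rw [← Real.sqrt_mul (by positivity)]
    refine Real.sqrt_le_iff.2 ⟨by positivity, ?_⟩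
    push_cast
    nlinarith
  have h2 : ‖(1 / 2 : ℂ)‖ₑ ≤ 1 := by
    rw [← ofReal_norm]
    norm_num
  rw [quad_apply, norm1_smul]
  calc _ ≤ 1 * ∑ p, ∑ q, ‖K p q‖ₑ * ((d + 2) * norm1 f) := by
        gcongr
        refine (norm1_sum _ _).trans (Finset.sum_le_sum fun p _ => ?_)
        refine (norm1_sum _ _).trans (Finset.sum_le_sum fun q _ => ?_)
        rw [norm1_smul]
        gcongr
        exact h1 p q
    _ = _ := by simp only [← Finset.sum_mul, one_mul, mul_assoc]

/-- After `m` applications the degree is at most `d + 2 m`, so the next one costs `c (d + 2 m + 2) ≤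
2 c (d + 1 + m)`; these factors multiply to an ascending factorial. -/
theorem norm1_pow_le {c : ℝ≥0∞} {A : Module.End ℂ (FinVec n)}
    (hdeg : ∀ (d : ℕ) (f : FinVec n), DegLE d f.1 → DegLE (d + 2) (A f).1)
    (hA : ∀ (d : ℕ) (f : FinVec n), DegLE d f.1 → norm1 (A f).1 ≤ c * (d + 2) * norm1 f.1)
    {d : ℕ} {f : FinVec n} (hf : DegLE d f.1) (m : ℕ) :
    DegLE (d + 2 * m) ((A ^ m) f).1 ∧
      norm1 ((A ^ m) f).1 ≤ (2 * c) ^ m * ((d + 1).ascFactorial m : ℕ) * norm1 f.1 := by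
  induction m with
  | zero => simpa using hf
  | succ m ih =>
    rw [pow_succ', Module.End.mul_apply]
    refine ⟨hdeg _ _ ih.1, (hA _ _ ih.1).trans ?_⟩
    refine (mul_le_mul_right ih.2 _).trans ?_
    rw [Nat.ascFactorial_succ]
    calc _ ≤ c * (2 * (d + 1 + m)) * ((2 * c) ^ m * ((d + 1).ascFactorial m : ℕ) * norm1 f.1) := by
          gcongr
          exact_mod_cast (show d + 2 * m + 2 ≤ 2 * (d + 1 + m) by omega)
      _ = _ := by
          push_cast
          ring

theorem ascFactorial_le (d m : ℕ) : (d + 1).ascFactorial m ≤ 2 ^ d * (m.factorial * 2 ^ m) := by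
  rw [Nat.ascFactorial_eq_factorial_mul_choose]
  have := Nat.choose_le_two_pow (d + m) m
  rw [pow_add] at this
  nlinarith [Nat.zero_le m.factorial]

/-- The operator `½ 𝔞ᵀ M 𝔞 + s` on the finite vectors. -/
def quadAdd (M : Matrix (Idx n) (Idx n) ℂ) (s : ℂ) : Module.End ℂ (FinVec n) :=
  quadFin M + s • LinearMap.id

/-- The finite vectors are analytic for `½ 𝔞ᵀ M 𝔞 + s`, with a radius of convergence independent
of the vector, also in the graph norm of the creation and annihilation operators. -/
theorem exists_analytic_bound (M : Matrix (Idx n) (Idx n) ℂ) (s : ℂ) :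
    ∃ R : ℝ, 0 ≤ R ∧ ∀ f : FinVec n, ∃ C : ℝ, ∀ (m : ℕ) (g : FinVec n),
      (norm1 g.1 ≤ norm1 ((quadAdd M s ^ m) f).1 ∨ ∃ p : Idx n,
        g.1 = ladder p ((quadAdd M s ^ m) f).1) →
      ‖toFock g‖ ≤ C * m.factorial * R ^ m := by
  set A := quadAdd M s
  set c : ℝ≥0∞ := ∑ p, ∑ q, ‖M p q‖ₑ + ‖s‖ₑ with hc
  have hctop : c ≠ ∞ := by
    refine ENNReal.add_ne_top.2 ⟨?_, enorm_ne_top⟩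
    exact ENNReal.sum_ne_top.2 fun p _ => ENNReal.sum_ne_top.2 fun q _ => enorm_ne_top
  have hAf (f : FinVec n) : (A f).1 = quad M f.1 + s • f.1 := rfl
  have hdeg (d : ℕ) (f : FinVec n) (hf : DegLE d f.1) : DegLE (d + 2) (A f).1 := by
    rw [hAf]
    exact (hf.quad M).add ((hf.mono (by omega)).smul s)
  have hA (d : ℕ) (f : FinVec n) (hf : DegLE d f.1) :
      norm1 (A f).1 ≤ c * (d + 2) * norm1 f.1 := by
    rw [hAf]
    refine (norm1_add _ _).trans ?_
    rw [norm1_smul, hc, add_mul, add_mul]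
    refine add_le_add (norm1_quad_le hf M) ?_
    gcongr
    refine le_mul_of_one_le_right' ?_
    calc (1 : ℝ≥0∞) ≤ 2 := by norm_num
      _ ≤ d + 2 := le_add_self
  -- Here `16 = 2 * 2 * 4`: one `2` from `norm1_pow_le`, one from `ascFactorial_le`, and `4` absorbs
  -- the degree growth under one further ladder operator.
  refine ⟨(16 * c).toReal, ENNReal.toReal_nonneg, fun f => ?_⟩
  obtain ⟨d, hd⟩ := exists_degLE f.2
  set C : ℝ≥0∞ := (d + 1 : ℕ) * 2 ^ d * norm1 f.1 with hC
  have hCtop : C ≠ ∞ := by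
    refine ENNReal.mul_ne_top (ENNReal.mul_ne_top (by simp) (by simp)) (norm1_lt_top f.2).ne
  refine ⟨C.toReal, fun m g hg => ?_⟩
  obtain ⟨h1, h2⟩ := norm1_pow_le hdeg hA hd m
  have h3 : norm1 g.1 ≤ ((d + 1) * 4 ^ m : ℕ) * norm1 ((A ^ m) f).1 := by
    have h4 : d + 2 * m + 1 ≤ (d + 1) * 4 ^ m := by
      have : 2 * m + 1 ≤ 4 ^ m := by
        clear * -
        induction m with
        | zero => simp
        | succ m ih => rw [pow_succ]; omega
      nlinarith
    rcases hg with hg | ⟨p, hg⟩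
    · refine hg.trans (le_mul_of_one_le_left' ?_)
      exact_mod_cast (show 1 ≤ (d + 1) * 4 ^ m by omega)
    · rw [hg]
      refine (norm1_ladder_le h1 p).trans ?_
      gcongr
      rw [← ENNReal.ofReal_natCast]
      refine ENNReal.ofReal_le_ofReal ?_
      have h5 : ((d + 2 * m : ℕ) : ℝ) + 1 ≤ ((d + 1) * 4 ^ m : ℕ) := by exact_mod_cast h4
      refine Real.sqrt_le_iff.2 ⟨by positivity, h5.trans ?_⟩
      refine le_self_pow₀ ?_ two_ne_zero
      exact_mod_cast (show 1 ≤ (d + 1) * 4 ^ m by omega)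
  have h6 : ‖toFock g‖ₑ ≤ C * m.factorial * (16 * c) ^ m := by
    refine (enorm_toFock_le g).trans (h3.trans ((mul_le_mul_right h2 _).trans ?_))
    calc _ ≤ (((d + 1) * 4 ^ m : ℕ) : ℝ≥0∞) *
          ((2 * c) ^ m * ((2 ^ d * (m.factorial * 2 ^ m) : ℕ) : ℝ≥0∞) * norm1 f.1) := by
          gcongr
          exact ascFactorial_le d m
      _ = C * m.factorial * (16 * c) ^ m := by
          rw [hC, show (16 : ℝ≥0∞) = 4 * (2 * 2) by norm_num]
          push_cast
          simp only [mul_pow]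
          ring
  have h7 := ENNReal.toReal_mono (by finiteness) h6
  simpa [ENNReal.toReal_mul] using h7

end Growth

/-! ### Coefficientwise convergence and density. -/

section Topology

variable {n : ℕ}

theorem continuous_coe_fock : Continuous fun f : Fock n => (⇑f : Coeff n) :=
  lp.uniformContinuous_coe.continuous

theorem continuous_ladder (p : Idx n) : Continuous (ladder p : Coeff n → Coeff n) := by
  rcases p with i | i
  · exact continuous_pi fun k => continuous_const.mul (continuous_apply _)
  · exact continuous_pi fun k => continuous_const.mul (continuous_apply _)

/-- Unbounded on `ℓ²`, these operators are continuous for coefficientwise convergence, because each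
output coefficient involves finitely many input ones. Identities thus extend from dense subsets. -/
theorem continuous_quad (K : Matrix (Idx n) (Idx n) ℂ) :
    Continuous (quad K : Coeff n → Coeff n) := by
  have h : (quad K : Coeff n → Coeff n) =
      fun f => (1 / 2 : ℂ) • ∑ p, ∑ q, K p q • ladder p (ladder q f) := funext (quad_apply K)
  rw [h]
  have h1 (p q : Idx n) : Continuous fun f : Coeff n => ladder p (ladder q f) :=
    (continuous_ladder p).comp (continuous_ladder q)
  fun_prop

theorem denseRange_toFock : DenseRange (toFock : FinVec n → Fock n) := fun f => by
  refine mem_closure_of_tendsto (lp.hasSum_single (p := 2) ENNReal.ofNat_ne_top f)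
    (Eventually.of_forall fun s => ?_)
  refine Submodule.sum_mem (LinearMap.range toFock) fun k _ => ?_
  refine ⟨⟨Pi.single k (f k), ?_⟩, rfl⟩
  exact (Set.finite_singleton k).subset Pi.support_single_subset

theorem denseRange_coe_finVec : DenseRange (fun f : FinVec n => f.1) := fun f => by
  classical
  refine mem_closure_of_tendsto (f := fun s : Finset (Occ n) => fun k => if k ∈ s then f k else 0)
    (b := atTop) (tendsto_pi_nhds.2 fun k => ?_) (Eventually.of_forall fun s => ?_)
  · refine tendsto_const_nhds.congr' ?_
    filter_upwards [eventually_ge_atTop {k}] with s hs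
    rw [if_pos (hs (Finset.mem_singleton_self k))]
  · refine ⟨⟨_, s.finite_toSet.subset fun k hk => ?_⟩, rfl⟩
    by_contra h
    exact hk (if_neg h)

theorem denseRange_coe_fock : DenseRange fun f : Fock n => (⇑f : Coeff n) := fun f =>
  closure_mono (by rintro _ ⟨g, rfl⟩; exact ⟨toFock g, rfl⟩) (denseRange_coe_finVec f)

end Topology

/-! ### Commuting the Gaussian operator past ladder and quadratic operators. -/

section Intertwining

variable {n : ℕ}

/-- The creation and annihilation operators on the finite vectors. -/
def ladderFin (p : Idx n) : Module.End ℂ (FinVec n) :=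
  (ladder p).restrict fun _ hf => ladder_mem p hf

/-- The embedding of the finite vectors as the graph of all creation and annihilation operators. -/
def graphEmb : FinVec n →ₗ[ℂ] Fock n × (Idx n → Fock n) :=
  toFock.prod (LinearMap.pi fun q => toFock ∘ₗ ladderFin q)

theorem graphEmb_apply (f : FinVec n) :
    graphEmb f = (toFock f, fun q => toFock (ladderFin q f)) := rfl

/-- The action `(x, y) ↦ (T t x, exp (t Y) T t y)` on the space containing the graph of the
creation and annihilation operators. -/
def twist (T : ℝ → (Fock n →L[ℂ] Fock n)) (Y : Matrix (Idx n) (Idx n) ℂ) (t : ℝ) :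
    (Fock n × (Idx n → Fock n)) →L[ℂ] (Fock n × (Idx n → Fock n)) :=
  ((T t).comp (ContinuousLinearMap.fst ℂ _ _)).prod (ContinuousLinearMap.pi fun q =>
    ∑ p, NormedSpace.exp (t • Y) q p •
      (T t).comp ((ContinuousLinearMap.proj p).comp (ContinuousLinearMap.snd ℂ _ _)))

theorem twist_apply (T : ℝ → (Fock n →L[ℂ] Fock n)) (Y : Matrix (Idx n) (Idx n) ℂ) (t : ℝ)
    (x : Fock n × (Idx n → Fock n)) :
    twist T Y t x = (T t x.1, fun q => ∑ p, NormedSpace.exp (t • Y) q p • T t (x.2 p)) := by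
  ext1
  · rfl
  · funext q
    simp [twist]

theorem hasDerivAt_exp_smul_apply {ι : Type*} [Fintype ι] [DecidableEq ι] (Y : Matrix ι ι ℂ)
    (q p : ι) (t : ℝ) :
    HasDerivAt (fun t : ℝ => NormedSpace.exp (t • Y) q p) ((NormedSpace.exp (t • Y) * Y) q p) t := by
  open scoped Matrix.Norms.Operator in
  have h := hasDerivAt_exp_smul_const (𝕂 := ℝ) Y t
  exact (LinearMap.toContinuousLinearMap
    (Matrix.entryLinearMap ℝ ℂ q p)).hasFDerivAt.comp_hasDerivAt t h

theorem isC0Semigroup_twist {T : ℝ → (Fock n →L[ℂ] Fock n)} (hT : IsC0Semigroup T)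
    (Y : Matrix (Idx n) (Idx n) ℂ) : IsC0Semigroup (twist T Y) where
  zero := by
    refine ContinuousLinearMap.ext fun x => ?_
    rw [twist_apply]
    ext1
    · simp [hT.zero]
    · funext q
      simp [hT.zero, Matrix.one_apply]
  add s t hs ht := by
    refine ContinuousLinearMap.ext fun x => ?_
    rw [mul_apply_eq_comp, twist_apply, twist_apply, twist_apply, hT.add s t hs ht]
    ext1
    · rfl
    · funext q
      have h : NormedSpace.exp ((s + t) • Y) = NormedSpace.exp (s • Y) * NormedSpace.exp (t • Y) := by
        rw [add_smul]
        exact Matrix.exp_add_of_commute _ _ (((Commute.refl Y).smul_left s).smul_right t)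
      simp only [h, Matrix.mul_apply, map_sum, map_smul, Finset.sum_smul, Finset.smul_sum, smul_smul,
        mul_apply_eq_comp]
      exact Finset.sum_comm
  continuousOn x := by
    simp only [twist_apply]
    refine (hT.continuousOn _).prodMk (continuousOn_pi.2 fun q => continuousOn_finsetSum _
      fun p _ => ContinuousOn.smul
      (f := fun t : ℝ => NormedSpace.exp (t • Y) q p) ?_ (hT.continuousOn _))
    exact fun t _ => (hasDerivAt_exp_smul_apply Y q p t).continuousAt.continuousWithinAt

theorem ladderFin_quadAdd {M : Matrix (Idx n) (Idx n) ℂ} (hM : Mᵀ = M) (s : ℂ) (q : Idx n)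
    (f : FinVec n) :
    ladderFin q (quadAdd M s f) =
      quadAdd M s (ladderFin q f) - ∑ p, (J n * M) q p • ladderFin p f := by
  have h := LinearMap.congr_fun (quadForm_comm (R := Module.End ℂ (Coeff n)) ladder_comm hM q) f.1
  rw [neg_neg, ← quad_eq] at h
  have h1 : quad M (ladder q f.1) - ladder q (quad M f.1) =
      ∑ p, (J n * M) q p • ladder p f.1 := by
    simpa [LinearMap.sum_apply] using h
  refine Subtype.ext ?_
  have h2 : (∑ p, (J n * M) q p • ladderFin p f).1 = ∑ p, (J n * M) q p • ladder p f.1 := by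
    rw [Submodule.coe_sum]; rfl
  rw [Submodule.coe_sub, h2, ← h1]
  change ladder q (quad M f.1 + s • f.1) = quad M (ladder q f.1) + s • ladder q f.1 - _
  rw [map_add, map_smul]
  abel

/-- The derivative of `exp (t Y)` with `Y = -(J M)` supplies exactly the commutator of a ladder
operator with the generator, so the twisted generator maps the graph to itself. -/
theorem hasDerivWithinAt_twist {T : ℝ → (Fock n →L[ℂ] Fock n)} (hT : IsC0Semigroup T)
    {M : Matrix (Idx n) (Idx n) ℂ} (hM : Mᵀ = M) (s : ℂ)
    (hA : ∀ f, HasDerivWithinAt (fun t => T t (toFock f)) (toFock (quadAdd M s f)) (Ici 0) 0)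
    (f : FinVec n) :
    HasDerivWithinAt (fun t => twist T (-(J n * M)) t (graphEmb f)) (graphEmb (quadAdd M s f))
      (Ici 0) 0 := by
  simp only [twist_apply, graphEmb_apply]
  refine (hA f).prodMk (hasDerivWithinAt_pi.2 fun q => ?_)
  have h := HasDerivWithinAt.fun_sum (u := Finset.univ) fun p _ =>
    ((hasDerivAt_exp_smul_apply (-(J n * M)) q p 0).hasDerivWithinAt (s := Ici 0)).smul
      (hA (ladderFin p f))
  refine h.congr_deriv ?_
  rw [ladderFin_quadAdd hM]
  simp [hT.zero, Finset.sum_add_distrib, Matrix.one_apply, map_sum, sub_eq_add_neg]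

theorem exists_graphEmb_bound (M : Matrix (Idx n) (Idx n) ℂ) (s : ℂ) :
    ∃ R : ℝ, 0 ≤ R ∧ ∀ f : FinVec n, ∃ C : ℝ, ∀ m : ℕ,
      ‖graphEmb ((quadAdd M s ^ m) f)‖ ≤ C * m.factorial * R ^ m := by
  obtain ⟨R, hR, h⟩ := exists_analytic_bound M s
  refine ⟨R, hR, fun f => ?_⟩
  obtain ⟨C, hC⟩ := h f
  refine ⟨C, fun m => ?_⟩
  have h0 := hC m _ (Or.inl le_rfl)
  refine max_le h0 ((pi_norm_le_iff_of_nonneg ((norm_nonneg _).trans h0)).2 fun q => ?_)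
  exact hC m _ (Or.inr ⟨q, rfl⟩)

theorem mem_graph_of_mem_closure {z : Fock n × (Idx n → Fock n)}
    (hz : z ∈ closure (range (graphEmb (n := n)))) (q : Idx n) :
    (⇑(z.2 q) : Coeff n) = ladder q ⇑z.1 := by
  have hclosed : IsClosed {z : Fock n × (Idx n → Fock n) | (⇑(z.2 q) : Coeff n) = ladder q ⇑z.1} :=
    isClosed_eq (continuous_coe_fock.comp ((continuous_apply q).comp continuous_snd))
      ((continuous_ladder q).comp (continuous_coe_fock.comp continuous_fst))
  refine closure_minimal ?_ hclosed hz
  rintro _ ⟨f, rfl⟩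
  rfl

/-- At time `1` the twisted semigroup sends the graph point of `f` into the closure of the graph,
where the second component is still the ladder operator applied to the first. -/
theorem IsExp.ladder_onFin {M : Matrix (Idx n) (Idx n) ℂ} (hM : Mᵀ = M) {s : ℂ}
    {ρ : Fock n →L[ℂ] Fock n} (hρ : IsExp (quadAdd M s) ρ) (q : Idx n) (f : FinVec n) :
    ladder q (onFin ρ f) =
      ∑ p, NormedSpace.exp (-(J n * M)) q p • onFin ρ (ladderFin p f) := by
  obtain ⟨T, hT, hgen, rfl⟩ := hρ
  have hA (f : FinVec n) :
      HasDerivWithinAt (fun t => T t (toFock f)) (toFock (quadAdd M s f)) (Ici 0) 0 := by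
    have h : (toFock f, toFock (quadAdd M s f)) ∈ generatorGraph T := by
      rw [hgen]; exact subset_closure ⟨f, rfl⟩
    exact h
  obtain ⟨R, hR, hC⟩ := exists_graphEmb_bound M s
  have h := mem_closure_range (isC0Semigroup_twist hT _) (hasDerivWithinAt_twist hT hM s hA) hR hC f
  have h1 := mem_graph_of_mem_closure h q
  rw [twist_apply, graphEmb_apply] at h1
  simp only [one_smul] at h1
  refine h1.symm.trans ?_
  simp only [lp.coeFn_sum, lp.coeFn_smul]
  rfl

theorem IsExp.denseRange {M : Matrix (Idx n) (Idx n) ℂ} {s : ℂ}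
    {ρ : Fock n →L[ℂ] Fock n} (hρ : IsExp (quadAdd M s) ρ) :
    DenseRange (onFin ρ : FinVec n → Coeff n) := by
  obtain ⟨T, hT, hgen, rfl⟩ := hρ
  have hA (f : FinVec n) :
      HasDerivWithinAt (fun t => T t (toFock f)) (toFock (quadAdd M s f)) (Ici 0) 0 := by
    have h : (toFock f, toFock (quadAdd M s f)) ∈ generatorGraph T := by
      rw [hgen]; exact subset_closure ⟨f, rfl⟩
    exact h
  obtain ⟨R, hR, hC⟩ := exists_graphEmb_bound M s
  have h := denseRange_one hT hA hR (fun f => (hC f).imp fun C hC m =>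
    (norm_fst_le (graphEmb ((quadAdd M s ^ m) f))).trans (hC m)) denseRange_toFock
  exact denseRange_coe_fock.comp (h.comp denseRange_toFock (T 1).continuous) continuous_coe_fock

theorem IsExp.onFin_ladderFin {M : Matrix (Idx n) (Idx n) ℂ} (hM : Mᵀ = M) {s : ℂ}
    {ρ : Fock n →L[ℂ] Fock n} (hρ : IsExp (quadAdd M s) ρ) (p : Idx n) (f : FinVec n) :
    onFin ρ (ladderFin p f) = ∑ q, NormedSpace.exp (J n * M) p q • ladder q (onFin ρ f) := by
  have h : NormedSpace.exp (J n * M) * NormedSpace.exp (-(J n * M)) = 1 := by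
    rw [← Matrix.exp_add_of_commute _ _ (Commute.refl (J n * M)).neg_right, add_neg_cancel,
      NormedSpace.exp_zero]
  simp only [hρ.ladder_onFin hM, Finset.smul_sum, smul_smul]
  rw [Finset.sum_comm]
  simp only [← Finset.sum_smul, ← Matrix.mul_apply, h]
  simp [Matrix.one_apply]

theorem quadFin_apply (K : Matrix (Idx n) (Idx n) ℂ) (f : FinVec n) :
    quadFin K f = (1 / 2 : ℂ) • ∑ p, ∑ q, K p q • ladderFin p (ladderFin q f) := by
  refine Subtype.ext ?_
  simp only [Submodule.coe_smul, Submodule.coe_sum]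
  exact quad_apply K f.1

theorem IsExp.onFin_quadFin {M : Matrix (Idx n) (Idx n) ℂ} (hM : Mᵀ = M) {s : ℂ}
    {ρ : Fock n →L[ℂ] Fock n} (hρ : IsExp (quadAdd M s) ρ) (K : Matrix (Idx n) (Idx n) ℂ)
    (f : FinVec n) :
    onFin ρ (quadFin K f) =
      quad ((NormedSpace.exp (J n * M))ᵀ * K * NormedSpace.exp (J n * M)) (onFin ρ f) := by
  rw [quadFin_apply, quad_apply]
  set S := NormedSpace.exp (J n * M)
  have h (r u : Idx n) : (Sᵀ * K * S) r u = ∑ p, ∑ q, K p q * S p r * S q u := by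
    simp only [Matrix.mul_apply, Finset.sum_mul, Matrix.transpose_apply]
    rw [Finset.sum_comm]
    exact Finset.sum_congr rfl fun _ _ => Finset.sum_congr rfl fun _ _ => by ring
  have h1 (p q : Idx n) : onFin ρ (ladderFin p (ladderFin q f)) =
      ∑ r, ∑ u, (S p r * S q u) • ladder r (ladder u (onFin ρ f)) := by
    simp only [hρ.onFin_ladderFin hM, map_sum, map_smul, Finset.smul_sum, smul_smul, S]
  simp only [map_smul, map_sum, h, h1]
  congr 1
  calc _ = ∑ p, ∑ q, ∑ r, ∑ u, (K p q * S p r * S q u) • ladder r (ladder u (onFin ρ f)) := by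
        simp only [Finset.smul_sum, smul_smul, mul_assoc]
    _ = ∑ r, ∑ p, ∑ q, ∑ u, (K p q * S p r * S q u) • ladder r (ladder u (onFin ρ f)) := by
        rw [Finset.sum_comm]
        exact (Finset.sum_congr rfl fun q _ => Finset.sum_comm).trans
          (Finset.sum_comm.trans (Finset.sum_congr rfl fun r _ => Finset.sum_comm))
    _ = _ := by
        refine Finset.sum_congr rfl fun r _ => ?_
        simp only [Finset.sum_smul]
        exact (Finset.sum_congr rfl fun p _ => Finset.sum_comm).trans Finset.sum_comm

end Intertwining

/-! ### The conjugation `tilde`, real vectors and symplectic exponentials. -/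

section MatrixLemmas

variable {n : ℕ}

theorem E_mul_E : E n * E n = 1 := by
  simp [E, Matrix.fromBlocks_multiply]

theorem E_transpose : (E n)ᵀ = E n := by
  simp [E, Matrix.fromBlocks_transpose]

theorem J_mul_J : J n * J n = -1 := by
  rw [← Matrix.fromBlocks_one, Matrix.fromBlocks_neg]
  simp [J, Matrix.fromBlocks_multiply]

theorem J_transpose : (J n)ᵀ = -J n := by
  simp [J, Matrix.fromBlocks_transpose, Matrix.fromBlocks_neg]

theorem tilde_mul (A B : Matrix (Idx n) (Idx n) ℂ) : tilde (A * B) = tilde A * tilde B := by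
  have h : tilde A * tilde B =
      E n * A.map (starRingEnd ℂ) * (E n * E n) * B.map (starRingEnd ℂ) * E n := by
    simp only [tilde, mul_assoc]
  rw [h, E_mul_E, mul_one, tilde, Matrix.map_mul]
  simp only [mul_assoc]

theorem tilde_transpose (A : Matrix (Idx n) (Idx n) ℂ) : tilde Aᵀ = (tilde A)ᵀ := by
  simp only [tilde, Matrix.transpose_mul, E_transpose, Matrix.transpose_map, mul_assoc]

theorem tilde_smul (c : ℝ) (A : Matrix (Idx n) (Idx n) ℂ) : tilde (c • A) = c • tilde A := by
  have h : (c • A).map (starRingEnd ℂ) = c • A.map (starRingEnd ℂ) := by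
    ext p q
    simp
  rw [tilde, h, mul_smul_comm, smul_mul_assoc, tilde]

theorem tilde_sub (A B : Matrix (Idx n) (Idx n) ℂ) : tilde (A - B) = tilde A - tilde B := by
  have h : (A - B).map (starRingEnd ℂ) = A.map (starRingEnd ℂ) - B.map (starRingEnd ℂ) := by
    ext p q
    simp
  rw [tilde, h, mul_sub, sub_mul, tilde, tilde]

theorem tilde_J : tilde (J n) = -J n := by
  have h : (J n).map (starRingEnd ℂ) = J n := by
    ext p q
    rcases p with p | p <;> rcases q with q | q <;> simp [J, Matrix.one_apply, apply_ite]
  rw [tilde, h]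
  simp [J, E, Matrix.fromBlocks_multiply, Matrix.fromBlocks_neg]

theorem tilde_exp (A : Matrix (Idx n) (Idx n) ℂ) :
    tilde (NormedSpace.exp A) = NormedSpace.exp (tilde A) := by
  have hE : (E n)⁻¹ = E n := Matrix.inv_eq_left_inv E_mul_E
  have hu : IsUnit (E n) := IsUnit.of_mul_eq_one _ E_mul_E
  have h := Matrix.exp_conj (E n) (A.map (starRingEnd ℂ)) hu
  rw [hE] at h
  rw [tilde, tilde, h]
  congr 2
  change ((NormedSpace.exp A)ᴴ)ᵀ = NormedSpace.exp (Aᴴ)ᵀ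
  rw [Matrix.exp_transpose, Matrix.exp_conjTranspose]

/-- The vectors `(α, ᾱ)`, the real form of `ℂ²ⁿ` belonging to the conjugation `tilde`. -/
def IsRealVec (w : Idx n → ℂ) : Prop := E n *ᵥ star w = w

/-- On real vectors a `tilde`-invariant form is thus real, and an anti-invariant one purely
imaginary. -/
theorem star_quadratic {w : Idx n → ℂ} (hw : IsRealVec w) (A : Matrix (Idx n) (Idx n) ℂ) :
    star (w ⬝ᵥ A *ᵥ w) = w ⬝ᵥ tilde A *ᵥ w := by
  have h1 : star w = E n *ᵥ w := by
    conv_rhs => rw [← hw]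
    rw [Matrix.mulVec_mulVec, E_mul_E, Matrix.one_mulVec]
  have h2 : star (w ⬝ᵥ A *ᵥ w) = star w ⬝ᵥ A.map (starRingEnd ℂ) *ᵥ star w := by
    simp [dotProduct, Matrix.mulVec]
  rw [h2, h1, tilde, ← Matrix.mulVec_mulVec, ← Matrix.mulVec_mulVec, Matrix.dotProduct_mulVec,
    Matrix.dotProduct_mulVec w, ← Matrix.mulVec_transpose (E n), E_transpose,
    ← Matrix.dotProduct_mulVec]

theorem exists_realVec (v : Idx n → ℂ) :
    ∃ w₁ w₂, IsRealVec w₁ ∧ IsRealVec w₂ ∧ v = w₁ + Complex.I • w₂ := by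
  set c := E n *ᵥ star v with hc
  have hvc : E n *ᵥ star c = v := by
    have h : star c = E n *ᵥ v := by
      ext p
      rcases p with p | p <;> simp [hc, E, Matrix.fromBlocks_mulVec, Pi.star_def]
    rw [h, Matrix.mulVec_mulVec, E_mul_E, Matrix.one_mulVec]
  refine ⟨(1 / 2 : ℂ) • (v + c), (-Complex.I / 2) • (v - c), ?_, ?_, ?_⟩
  · rw [IsRealVec, star_smul, Matrix.mulVec_smul, star_add, Matrix.mulVec_add, ← hc, hvc, add_comm]
    simp
  · rw [IsRealVec, star_smul, Matrix.mulVec_smul, star_sub, Matrix.mulVec_sub, ← hc, hvc,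
      ← neg_sub v c, smul_neg, ← neg_smul]
    congr 1
    simp
    ring
  · rw [smul_smul, show Complex.I * (-Complex.I / 2) = 1 / 2 by
      rw [mul_div_assoc', mul_neg, Complex.I_mul_I, neg_neg]]
    module

/-- Polarisation on real vectors, then complex bilinearity, as the real vectors span. -/
theorem eq_zero_of_quadratic_eq_zero {A : Matrix (Idx n) (Idx n) ℂ} (hA : Aᵀ = A)
    (h : ∀ w, IsRealVec w → w ⬝ᵥ A *ᵥ w = 0) : A = 0 := by
  have hsymm (v w : Idx n → ℂ) : w ⬝ᵥ A *ᵥ v = v ⬝ᵥ A *ᵥ w := by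
    rw [Matrix.dotProduct_mulVec, ← Matrix.mulVec_transpose, hA, dotProduct_comm]
  have hreal (v w : Idx n → ℂ) (hv : IsRealVec v) (hw : IsRealVec w) : v ⬝ᵥ A *ᵥ w = 0 := by
    have hvw : IsRealVec (v + w) := by
      rw [IsRealVec, star_add, Matrix.mulVec_add, hv, hw]
    have h1 := h _ hvw
    simp only [Matrix.mulVec_add, add_dotProduct, dotProduct_add, h v hv, h w hw, hsymm v w] at h1
    simpa [← two_mul] using h1
  have hall (v w : Idx n → ℂ) : v ⬝ᵥ A *ᵥ w = 0 := by
    obtain ⟨v₁, v₂, hv₁, hv₂, rfl⟩ := exists_realVec v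
    obtain ⟨w₁, w₂, hw₁, hw₂, rfl⟩ := exists_realVec w
    simp only [Matrix.mulVec_add, Matrix.mulVec_smul, add_dotProduct, dotProduct_add,
      smul_dotProduct, dotProduct_smul, hreal _ _ hv₁ hw₁, hreal _ _ hv₁ hw₂, hreal _ _ hv₂ hw₁,
      hreal _ _ hv₂ hw₂, smul_zero, add_zero]
  ext p q
  simpa using hall (Pi.single p 1) (Pi.single q 1)

theorem eq_of_sum_sq_sub_eq_zero {N : ℕ} {K : Fin N → Matrix (Idx n) (Idx n) ℂ}
    (hK : ∀ j, (K j)ᵀ = K j) (hK' : ∀ j, tilde (K j) = K j) {X : Matrix (Idx n) (Idx n) ℂ}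
    (hX : tilde X = -X)
    (h : ∀ z : Idx n → ℂ, ∑ j, (z ⬝ᵥ K j *ᵥ z -
      z ⬝ᵥ ((NormedSpace.exp X)ᵀ * K j * NormedSpace.exp X) *ᵥ z) ^ 2 = 0) (j : Fin N) :
    (NormedSpace.exp X)ᵀ * K j * NormedSpace.exp X = K j := by
  set P := NormedSpace.exp ((1 / 2 : ℝ) • X) with hP
  set Q := NormedSpace.exp (-((1 / 2 : ℝ) • X)) with hQ
  have hPQ : P * Q = 1 := by
    rw [hP, hQ, ← Matrix.exp_add_of_commute _ _ (Commute.refl ((1 / 2 : ℝ) • X)).neg_right,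
      add_neg_cancel, NormedSpace.exp_zero]
  have hQP : Q * P = 1 := mul_eq_one_comm.1 hPQ
  have hPP : NormedSpace.exp X = P * P := by
    rw [hP, ← Matrix.exp_add_of_commute _ _ (Commute.refl _), ← add_smul]
    norm_num
  have htP : tilde P = Q := by
    rw [hP, tilde_exp, tilde_smul, hX, smul_neg]
  have htQ : tilde Q = P := by
    have hnX : tilde (-X) = X := by simpa [hX] using tilde_smul (-1) X
    rw [hQ, ← smul_neg, tilde_exp, tilde_smul, hnX]
  -- Splitting `exp X` into two halves makes the difference anti-invariant: `tilde` exchanges `P`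
  -- and `Q`.
  set Y : Fin N → Matrix (Idx n) (Idx n) ℂ := fun j => Qᵀ * K j * Q - Pᵀ * K j * P with hY
  have htY (j) : tilde (Y j) = -Y j := by
    simp only [hY, tilde_sub, tilde_mul, tilde_transpose, hK', htP, htQ, neg_sub]
  have hquad (A B : Matrix (Idx n) (Idx n) ℂ) (w : Idx n → ℂ) :
      (A *ᵥ w) ⬝ᵥ B *ᵥ (A *ᵥ w) = w ⬝ᵥ (Aᵀ * B * A) *ᵥ w := by
    rw [← Matrix.mulVec_mulVec, ← Matrix.mulVec_mulVec, Matrix.dotProduct_mulVec w,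
      Matrix.vecMul_transpose]
  have hzero (j : Fin N) (w : Idx n → ℂ) (hw : IsRealVec w) : w ⬝ᵥ Y j *ᵥ w = 0 := by
    have him (j) : (w ⬝ᵥ Y j *ᵥ w).re = 0 := by
      have h1 := congrArg Complex.re (star_quadratic hw (Y j))
      rw [htY, Matrix.neg_mulVec, dotProduct_neg, Complex.neg_re] at h1
      have h2 : (w ⬝ᵥ Y j *ᵥ w).re = -(w ⬝ᵥ Y j *ᵥ w).re := h1
      linarith
    have h1 : ∑ j, (w ⬝ᵥ Y j *ᵥ w) ^ 2 = 0 := by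
      -- At `z = Q w` the two forms become `Qᵀ K Q` and `Pᵀ K P` at `w`, because `P P Q = P`.
      rw [← h (Q *ᵥ w)]
      refine Finset.sum_congr rfl fun j _ => ?_
      rw [hquad, hquad, hPP, ← dotProduct_sub, ← Matrix.sub_mulVec]
      have h2 : Qᵀ * ((P * P)ᵀ * K j * (P * P)) * Q = Pᵀ * K j * P := by
        have h3 : P * P * Q = P := by rw [mul_assoc, hPQ, mul_one]
        have h4 : Qᵀ * (P * P)ᵀ = Pᵀ := by rw [← Matrix.transpose_mul, h3]
        rw [mul_assoc, mul_assoc, h3, ← mul_assoc, ← mul_assoc, h4]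
      rw [h2]
    have h2 := congrArg Complex.re h1
    rw [Complex.re_sum, Complex.zero_re] at h2
    have h3 : ∑ j, (w ⬝ᵥ Y j *ᵥ w).im ^ 2 = 0 := by
      rw [← neg_eq_zero, ← h2, ← Finset.sum_neg_distrib]
      refine Finset.sum_congr rfl fun j _ => ?_
      rw [pow_two, pow_two, Complex.mul_re, him]
      ring
    have h4 := (Finset.sum_eq_zero_iff_of_nonneg fun j _ => sq_nonneg _).1 h3 j (Finset.mem_univ j)
    exact Complex.ext (him j) (by simpa using h4)
  have hYj : Y j = 0 := by
    refine eq_zero_of_quadratic_eq_zero ?_ (hzero j)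
    simp only [hY, Matrix.transpose_sub, Matrix.transpose_mul, Matrix.transpose_transpose, hK,
      mul_assoc]
  have h1 : Pᵀ * K j * P = Qᵀ * K j * Q := (sub_eq_zero.1 hYj).symm
  calc _ = Pᵀ * (Pᵀ * K j * P) * P := by rw [hPP, Matrix.transpose_mul]; simp only [mul_assoc]
    _ = (Q * P)ᵀ * K j * (Q * P) := by rw [h1, Matrix.transpose_mul]; simp only [mul_assoc]
    _ = K j := by rw [hQP, Matrix.transpose_one, one_mul, mul_one]

/-- With `S = exp (J M)` and `G = exp (M J)`, conjugation by `J` gives `S J = J G`, and symmetry of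
`M` gives `G Sᵀ = 1`. So `Sᵀ K S = K` reads `K S = G K`, and multiplying by `J` on the right gives
the commutator. -/
theorem conj_exp_eq_iff_commute {M : Matrix (Idx n) (Idx n) ℂ} (hM : Mᵀ = M)
    (K : Matrix (Idx n) (Idx n) ℂ) :
    (NormedSpace.exp (J n * M))ᵀ * K * NormedSpace.exp (J n * M) = K ↔
      Commute (K * J n) (NormedSpace.exp (M * J n)) := by
  have hJ : (J n)⁻¹ = -J n := Matrix.inv_eq_left_inv (by rw [neg_mul, J_mul_J, neg_neg])
  have hu : IsUnit (J n) := IsUnit.of_mul_eq_one (-J n) (by rw [mul_neg, J_mul_J, neg_neg])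
  set G := NormedSpace.exp (M * J n) with hG
  have hS : NormedSpace.exp (J n * M) * J n = J n * G := by
    have h := Matrix.exp_conj (J n) (M * J n) hu
    have h1 : J n * (M * J n) * (J n)⁻¹ = J n * M := by
      rw [hJ, mul_neg, mul_assoc, mul_assoc, J_mul_J]
      simp
    rw [h1, hJ] at h
    rw [h, mul_assoc, neg_mul, J_mul_J, neg_neg, mul_one]
  have hG' : G * (NormedSpace.exp (J n * M))ᵀ = 1 := by
    rw [← Matrix.exp_transpose, Matrix.transpose_mul, hM, J_transpose, mul_neg, hG,
      ← Matrix.exp_add_of_commute _ _ (Commute.refl (M * J n)).neg_right,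
      add_neg_cancel, NormedSpace.exp_zero]
  have hG'' := mul_eq_one_comm.1 hG'
  set S := NormedSpace.exp (J n * M)
  calc Sᵀ * K * S = K ↔ K * S = G * K := by
        constructor
        · intro h
          conv_rhs => rw [← h]
          rw [mul_assoc Sᵀ, ← mul_assoc G, hG', one_mul]
        · intro h
          rw [mul_assoc, h, ← mul_assoc, hG'', one_mul]
    _ ↔ K * S * J n = G * K * J n := hu.mul_left_inj.symm
    _ ↔ _ := by rw [mul_assoc, hS, ← mul_assoc, mul_assoc G]; rfl

end MatrixLemmas

/-! ### The stationarity criterion. -/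

section Stationary

variable {n N : ℕ}

theorem isStationary_iff (K : Fin N → Matrix (Idx n) (Idx n) ℂ) (ρ : Fock n →L[ℂ] Fock n) :
    IsStationary K ρ ↔ ∀ ψ, generator K (onFin ρ) ψ = 0 := by
  constructor
  · intro h ψ
    funext k
    exact ((uniqueDiffOn_Ici (0 : ℝ)) 0 self_mem_Ici).eq_deriv _ (h 0 le_rfl ψ k)
      (hasDerivWithinAt_const _ _ _)
  · intro h t _ ψ k
    rw [h ψ]
    exact hasDerivWithinAt_const _ _ _

/-- Once `X` is moved to the right, the double commutator becomes a polynomial in the ladder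
operators acting on `X ψ`. -/
theorem generator_apply {K K' : Fin N → Matrix (Idx n) (Idx n) ℂ} {X : FinVec n →ₗ[ℂ] Coeff n}
    (hX : ∀ j ψ, X (quadFin (K j) ψ) = quad (K' j) (X ψ)) (ψ : FinVec n) :
    generator K X ψ = -((1 / 2 : ℂ) • ∑ j, (quad (K j) (quad (K j) (X ψ)) -
      (2 : ℂ) • quad (K j) (quad (K' j) (X ψ)) + quad (K' j) (quad (K' j) (X ψ)))) := by
  simp only [generator, LinearMap.neg_apply, LinearMap.smul_apply, LinearMap.sum_apply]
  congr 2
  refine Finset.sum_congr rfl fun j _ => ?_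
  simp only [comm, LinearMap.sub_apply, LinearMap.comp_apply, map_sub, hX]
  module

theorem IsGaussianState.isStationary_iff {K : Fin N → Matrix (Idx n) (Idx n) ℂ}
    (hK_symm : ∀ j, (K j)ᵀ = K j) (hK_tilde : ∀ j, tilde (K j) = K j)
    {M : Matrix (Idx n) (Idx n) ℂ} {s : ℝ} {ρ : Fock n →L[ℂ] Fock n}
    (hρ : IsGaussianState M s ρ) :
    IsStationary K ρ ↔
      ∀ j, (NormedSpace.exp (J n * M))ᵀ * K j * NormedSpace.exp (J n * M) = K j := by
  have hexp : IsExp (quadAdd M s) ρ := hρ.eq_exp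
  set K' : Fin N → Matrix (Idx n) (Idx n) ℂ := fun j =>
    (NormedSpace.exp (J n * M))ᵀ * K j * NormedSpace.exp (J n * M) with hK'
  have hgen := generator_apply (K' := K') fun j ψ => hexp.onFin_quadFin hρ.symm (K j) ψ
  rw [BosonicGKSL.isStationary_iff]
  constructor
  · intro h
    simp only [hgen, neg_eq_zero, smul_eq_zero, one_div, inv_eq_zero, OfNat.ofNat_ne_zero,
      false_or] at h
    have hcont : Continuous fun f : Coeff n => ∑ j, (quad (K j) (quad (K j) f) -
        (2 : ℂ) • quad (K j) (quad (K' j) f) + quad (K' j) (quad (K' j) f)) := by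
      have hc (A B : Matrix (Idx n) (Idx n) ℂ) : Continuous fun f : Coeff n => quad A (quad B f) :=
        (continuous_quad A).comp (continuous_quad B)
      fun_prop
    -- Density of the range of `ρ` and continuity allow `ρ` to be cancelled.
    have hzero (f : Coeff n) : ∑ j, (quad (K j) (quad (K j) f) -
        (2 : ℂ) • quad (K j) (quad (K' j) f) + quad (K' j) (quad (K' j) f)) = 0 :=
      hexp.denseRange.induction_on f (isClosed_eq hcont continuous_const) h
    refine eq_of_sum_sq_sub_eq_zero hK_symm hK_tilde (X := J n * M) ?_ ?_
    · rw [tilde_mul, tilde_J, hρ.tilde_eq, neg_mul]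
    · refine sum_sq_sub_eq_zero (R := Module.End ℂ (Coeff n)) (L := ladder) (Ω := -J n) (Ω' := J n)
        (by rw [mul_neg, J_mul_J, neg_neg]) ladder_comm hK_symm (K' := K') ?_ ?_
      · intro j
        simp only [hK', Matrix.transpose_mul, Matrix.transpose_transpose, hK_symm, mul_assoc]
      · refine LinearMap.ext fun f => ?_
        simp only [← quad_eq, LinearMap.sum_apply]
        exact hzero f
  · intro h ψ
    rw [hgen]
    simp only [hK', h]
    have h0 (f : Coeff n) : f - (2 : ℂ) • f + f = 0 := by module
    simp [h0]

end Stationary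

end BosonicGKSL

end

theorem theorem2 (n N : ℕ)
    (K : Fin N → Matrix (BosonicGKSL.Idx n) (BosonicGKSL.Idx n) ℂ)
    (hK_symm : ∀ j, (K j)ᵀ = K j) (hK_tilde : ∀ j, BosonicGKSL.tilde (K j) = K j)
    (M : Matrix (BosonicGKSL.Idx n) (BosonicGKSL.Idx n) ℂ) (s : ℝ)
    (ρ : BosonicGKSL.Fock n →L[ℂ] BosonicGKSL.Fock n)
    (hρ : BosonicGKSL.IsGaussianState M s ρ) :
    BosonicGKSL.IsStationary K ρ ↔
      ∀ j, Commute (K j * BosonicGKSL.J n) (NormedSpace.exp (M * BosonicGKSL.J n)) :=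
  (hρ.isStationary_iff hK_symm hK_tilde).trans
    (forall_congr' fun j => BosonicGKSL.conj_exp_eq_iff_commute hρ.symm (K j))
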